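/- Let $\rho_1,\dots,\rho_n$ be density operators on $\mathbb{C}^2\otimes\mathbb{C}^2$, where party $A$ holds the first and party $B$ the second qubit of each pair, and suppose that none of the $\rho_i$ is a pure entangled state (for instance, all of them are mixed, i.e. not pure). Suppose that the joint state $\rho_1\otimes\cdots\otimes\rho_n$ can be distilled to a pure singlet with nonzero probability by local operations and classical communication (LOCC) between $A$ and $B$. That is, there are a protocol with finitely many rounds, in each of which one party performs a local generalized measurement with finitely many outcomes and announces the outcome, every later operation being allowed to depend on the earlier outcomes, and a number $p>0$, such that with probability $p$ the protocol declares success, and the two-qubit state of $A$ and $B$ conditioned on success is a maximally entangled pure state, i.e. $(|01\rangle-|10\rangle)/\sqrt2$ up to local unitaries. Then there are at least two indices $i$ such that the range of $\rho_i$ is not the linear span of the product vectors $x\otimes y$ contained in it. -/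

import Mathlib

open scoped Matrix Kronecker ComplexOrder

/-- Operators on `ℂ^a ⊗ ℂ^b` in the computational product basis: the first index belongs to `A`,
the second one to `B`. -/
abbrev BipartiteOp (a b : ℕ) : Type := Matrix (Fin a × Fin b) (Fin a × Fin b) ℂ

/-- Density operators. -/
def IsState {a b : ℕ} (ρ : BipartiteOp a b) : Prop := ρ.PosSemidef ∧ ρ.trace = 1

/-- The rank-one operator `|ψ⟩⟨ψ|`. -/
def ketBra {a b : ℕ} (ψ : Fin a × Fin b → ℂ) : BipartiteOp a b :=
  Matrix.vecMulVec ψ (star ψ)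

/-- The vector `x ⊗ y` in the product basis. -/
def productKet {a b : ℕ} (x : Fin a → ℂ) (y : Fin b → ℂ) : Fin a × Fin b → ℂ :=
  fun i => x i.1 * y i.2

/-- `ψ = x ⊗ y` for some `x`, `y`. The zero vector is allowed; this is irrelevant for spans and
for vectors of states. -/
def IsProductKet {a b : ℕ} (ψ : Fin a × Fin b → ℂ) : Prop :=
  ∃ (x : Fin a → ℂ) (y : Fin b → ℂ), ψ = productKet x y

/-- The state is pure, `ρ = |ψ⟩⟨ψ|`, and `ψ` is not a product vector. -/
def IsPureEntangled {a b : ℕ} (ρ : BipartiteOp a b) : Prop :=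
  ∃ ψ : Fin a × Fin b → ℂ, ρ = ketBra ψ ∧ ¬ IsProductKet ψ

/-- The range `R(ρ)` of an operator. -/
def opRange {a b : ℕ} (ρ : BipartiteOp a b) : Submodule ℂ (Fin a × Fin b → ℂ) :=
  LinearMap.range ρ.mulVecLin

/-- The range of `ρ` is the linear span of the product vectors which it contains. -/
def RangeSpannedByProducts {a b : ℕ} (ρ : BipartiteOp a b) : Prop :=
  Submodule.span ℂ {ψ | ψ ∈ opRange ρ ∧ IsProductKet ψ} = opRange ρ

/-- The joint state `ρ₁ ⊗ ⋯ ⊗ ρₙ` of `n` two-qubit states, where `A` holds the first and `B` the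
second qubit of every pair. The computational basis of the `n` qubits of either party is numbered
by `Fin (2 ^ n)`, through binary expansion. -/
def jointState {n : ℕ} (ρ : Fin n → BipartiteOp 2 2) : BipartiteOp (2 ^ n) (2 ^ n) :=
  Matrix.of fun x y =>
    ∏ i, ρ i (finFunctionFinEquiv.symm x.1 i, finFunctionFinEquiv.symm x.2 i)
      (finFunctionFinEquiv.symm y.1 i, finFunctionFinEquiv.symm y.2 i)

/-- Protocols of local operations and classical communication, with finitely many rounds, started
on a system `ℂ^a ⊗ ℂ^b` and aiming at a pair of qubits. In each round one party performs a
generalized measurement with Kraus operators `K i` (`∑ i, (K i)ᴴ * K i = 1`) on its own system,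
possibly changing its dimension (so that local ancillas, unitaries and discarding of subsystems
are included), and communicates the outcome; everything that follows may depend on it. In the end
the protocol either declares success and hands over a pair of qubits, or declares failure. -/
inductive LOCC : ℕ → ℕ → Type
  | success : LOCC 2 2
  | failure {a b : ℕ} : LOCC a b
  | measureA {a b a' k : ℕ} (K : Fin k → Matrix (Fin a') (Fin a) ℂ)
      (hK : ∑ i, (K i)ᴴ * K i = 1) (next : Fin k → LOCC a' b) : LOCC a b
  | measureB {a b b' k : ℕ} (K : Fin k → Matrix (Fin b') (Fin b) ℂ)
      (hK : ∑ i, (K i)ᴴ * K i = 1) (next : Fin k → LOCC a b') : LOCC a b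

/-- The unnormalized final state of the pair of qubits, conditioned on success: the sum of the
contributions of all successful branches. For an initial density operator, its trace is the
probability of success. -/
noncomputable def LOCC.output : {a b : ℕ} → LOCC a b → BipartiteOp a b → BipartiteOp 2 2
  | _, _, .success, ρ => ρ
  | _, _, .failure, _ => 0
  | _, b, .measureA K _ next, ρ =>
      ∑ i, (next i).output
        ((K i ⊗ₖ (1 : Matrix (Fin b) (Fin b) ℂ)) * ρ * (K i ⊗ₖ (1 : Matrix (Fin b) (Fin b) ℂ))ᴴ)
  | a, _, .measureB K _ next, ρ =>
      ∑ i, (next i).output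
        (((1 : Matrix (Fin a) (Fin a) ℂ) ⊗ₖ K i) * ρ * ((1 : Matrix (Fin a) (Fin a) ℂ) ⊗ₖ K i)ᴴ)

/-- The vector `(|01⟩ - |10⟩) / √2`. -/
noncomputable def singletKet : Fin 2 × Fin 2 → ℂ := fun i =>
  if i = (0, 1) then ((1 / Real.sqrt 2 : ℝ) : ℂ)
  else if i = (1, 0) then -((1 / Real.sqrt 2 : ℝ) : ℂ)
  else 0

/-- A singlet up to local unitaries, that is, a maximally entangled two-qubit vector, such as
`(|01⟩ - |10⟩) / √2` or `(|00⟩ + |11⟩) / √2`. -/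
def IsSinglet (ψ : Fin 2 × Fin 2 → ℂ) : Prop :=
  ∃ U ∈ Matrix.unitaryGroup (Fin 2) ℂ, ∃ V ∈ Matrix.unitaryGroup (Fin 2) ℂ,
    ψ = (U ⊗ₖ V) *ᵥ singletKet

/-- Some LOCC protocol turns `ρ` into a pure singlet with a nonzero probability `p`. -/
def DistillableToSinglet {a b : ℕ} (ρ : BipartiteOp a b) : Prop :=
  ∃ (P : LOCC a b) (p : ℝ) (ψ : Fin 2 × Fin 2 → ℂ),
    0 < p ∧ IsSinglet ψ ∧ P.output ρ = (p : ℂ) • ketBra ψ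

/-! Suppose that at most one range, that of `ρ i`, is not spanned by product vectors. Since the
output is pure, a single branch `A ⊗ B` of the protocol already yields a nonzero multiple of
`|ψ⟩⟨ψ|` (`LOCC.exists_branch`), so `A ⊗ B` maps the range of the joint state into the line of `ψ`,
and not to zero.

Some tensor product of vectors `w j` from the ranges therefore survives, and by linearity every `w
j` with `j ≠ i` may be taken to be a product vector. Then `A ⊗ B` acts on factor `i` as a local
operator `A' ⊗ B'` between qubit pairs. As it sends `w i` to a nonzero multiple of the entangled
`ψ`, comparing determinants of coefficient matrices shows that `A'` and `B'` are invertible and `w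
i` is entangled. The whole range of `ρ i` goes into the line of `ψ`, hence is the line of `w i`: `ρ
i` is pure and entangled, a contradiction. -/

/-! ### Coefficient matrices and entanglement of two qubits -/

/-- The coefficient matrix of a bipartite vector. -/
def unvec {a b : ℕ} (φ : Fin a × Fin b → ℂ) : Matrix (Fin a) (Fin b) ℂ :=
  Matrix.of fun i j => φ (i, j)

theorem unvec_kronecker_mulVec {a b a' b' : ℕ} (A : Matrix (Fin a') (Fin a) ℂ)
    (B : Matrix (Fin b') (Fin b) ℂ) (φ : Fin a × Fin b → ℂ) :
    unvec ((A ⊗ₖ B) *ᵥ φ) = A * unvec φ * Bᵀ := by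
  ext i j
  simp only [unvec, Matrix.of_apply, Matrix.mulVec, dotProduct, Matrix.mul_apply,
    Matrix.transpose_apply, Fintype.sum_prod_type, Matrix.kroneckerMap_apply, Finset.sum_mul]
  rw [Finset.sum_comm]
  refine Finset.sum_congr rfl fun _ _ => Finset.sum_congr rfl fun _ _ => ?_
  ring

theorem unvec_injective {a b : ℕ} : Function.Injective (unvec (a := a) (b := b)) := by
  intro φ χ h
  ext ⟨i, j⟩
  exact congrFun (congrFun h i) j

theorem unvec_smul {a b : ℕ} (c : ℂ) (φ : Fin a × Fin b → ℂ) : unvec (c • φ) = c • unvec φ := rfl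

theorem det_unvec_eq_zero_of_isProductKet {φ : Fin 2 × Fin 2 → ℂ} (h : IsProductKet φ) :
    (unvec φ).det = 0 := by
  obtain ⟨x, y, rfl⟩ := h
  rw [Matrix.det_fin_two]
  simp only [unvec, productKet, Matrix.of_apply]
  ring

/-- Local unitaries multiply the determinant by nonzero factors, and the singlet has determinant
`1/2`. -/
theorem IsSinglet.det_unvec_ne_zero {ψ : Fin 2 × Fin 2 → ℂ} (h : IsSinglet ψ) :
    (unvec ψ).det ≠ 0 := by
  obtain ⟨U, hU, V, hV, rfl⟩ := h
  have hunit : ∀ W ∈ Matrix.unitaryGroup (Fin 2) ℂ, W.det ≠ 0 := fun W hW h0 => by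
    have := congrArg Matrix.det (Matrix.mem_unitaryGroup_iff.1 hW)
    simp [Matrix.det_mul, h0] at this
  rw [unvec_kronecker_mulVec, Matrix.det_mul, Matrix.det_mul, Matrix.det_transpose]
  refine mul_ne_zero (mul_ne_zero (hunit U hU) ?_) (hunit V hV)
  rw [Matrix.det_fin_two]
  simp [unvec, singletKet]

theorem IsProductKet.kronecker_mulVec {a b a' b' : ℕ} (A : Matrix (Fin a') (Fin a) ℂ)
    (B : Matrix (Fin b') (Fin b) ℂ) {φ : Fin a × Fin b → ℂ} (h : IsProductKet φ) :
    IsProductKet ((A ⊗ₖ B) *ᵥ φ) := by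
  obtain ⟨x, y, rfl⟩ := h
  refine ⟨A *ᵥ x, B *ᵥ y, ?_⟩
  ext ⟨i, j⟩
  simp only [productKet, Matrix.mulVec, dotProduct, Fintype.sum_prod_type,
    Matrix.kroneckerMap_apply, Finset.sum_mul_sum]
  refine Finset.sum_congr rfl fun _ _ => Finset.sum_congr rfl fun _ _ => ?_
  ring

/-! ### From a protocol to a single product operator -/

open scoped MatrixOrder in
theorem exists_eq_conjTranspose_mul_self {ι : Type*} [Fintype ι] {ρ : Matrix ι ι ℂ}
    (h : ρ.PosSemidef) : ∃ N : Matrix ι ι ℂ, ρ = Nᴴ * N := by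
  classical
  refine ⟨CFC.sqrt ρ, ?_⟩
  have hS : (CFC.sqrt ρ)ᴴ = CFC.sqrt ρ :=
    (Matrix.nonneg_iff_posSemidef.1 (CFC.sqrt_nonneg ρ)).isHermitian
  rw [hS, CFC.sqrt_mul_sqrt_self ρ h.nonneg]

/-- The support of the positive semidefinite operator `σ` lies in the line of `ψ`. -/
def SupportedOn {ι : Type*} [Fintype ι] (σ : Matrix ι ι ℂ) (ψ : ι → ℂ) : Prop :=
  ∀ u : ι → ℂ, star u ⬝ᵥ ψ = 0 → star u ⬝ᵥ (σ *ᵥ u) = 0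

theorem supportedOn_ketBra {a b : ℕ} (c : ℂ) (ψ : Fin a × Fin b → ℂ) :
    SupportedOn (c • ketBra ψ) ψ := by
  intro u hu
  rw [ketBra, Matrix.smul_mulVec, Matrix.vecMulVec_mulVec, dotProduct_smul, dotProduct_smul]
  simp [hu]

/-- Nonnegative numbers with sum zero all vanish; a mixture is thus pure only if each of its
branches is. -/
theorem SupportedOn.of_sum {ι κ : Type*} [Fintype ι] [Fintype κ] {σ : κ → Matrix ι ι ℂ}
    (hσ : ∀ k, (σ k).PosSemidef) {ψ : ι → ℂ} (h : SupportedOn (∑ k, σ k) ψ) (k : κ) :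
    SupportedOn (σ k) ψ := by
  intro u hu
  have h0 := h u hu
  rw [Matrix.sum_mulVec, dotProduct_sum] at h0
  exact (Finset.sum_eq_zero_iff_of_nonneg
    fun k _ => (hσ k).dotProduct_mulVec_nonneg u).1 h0 k (Finset.mem_univ k)

theorem LOCC.posSemidef_output {a b : ℕ} (P : LOCC a b) :
    ∀ {ρ : BipartiteOp a b}, ρ.PosSemidef → (P.output ρ).PosSemidef := by
  induction P with
  | success => exact fun h => h
  | failure => exact fun _ => Matrix.PosSemidef.zero
  | measureA K hK next ih =>
    exact fun h => Matrix.posSemidef_sum _ fun i _ => ih i (h.mul_mul_conjTranspose_same _)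
  | measureB K hK next ih =>
    exact fun h => Matrix.posSemidef_sum _ fun i _ => ih i (h.mul_mul_conjTranspose_same _)

theorem kronecker_conj_kronecker_conj {a b a' b' a'' b'' : ℕ}
    (A : Matrix (Fin a'') (Fin a') ℂ) (B : Matrix (Fin b'') (Fin b') ℂ)
    (C : Matrix (Fin a') (Fin a) ℂ) (D : Matrix (Fin b') (Fin b) ℂ) (X : BipartiteOp a b) :
    (A ⊗ₖ B) * ((C ⊗ₖ D) * X * (C ⊗ₖ D)ᴴ) * (A ⊗ₖ B)ᴴ =
      ((A * C) ⊗ₖ (B * D)) * X * ((A * C) ⊗ₖ (B * D))ᴴ := by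
  rw [Matrix.mul_kronecker_mul, Matrix.conjTranspose_mul]
  simp only [Matrix.mul_assoc]

/-- A protocol whose successful output is pure has a branch, acting by a product operator, which
already produces that output. -/
theorem LOCC.exists_branch {a b : ℕ} (P : LOCC a b) {ψ : Fin 2 × Fin 2 → ℂ} :
    ∀ {ρ : BipartiteOp a b}, ρ.PosSemidef → P.output ρ ≠ 0 → SupportedOn (P.output ρ) ψ →
      ∃ (A : Matrix (Fin 2) (Fin a) ℂ) (B : Matrix (Fin 2) (Fin b) ℂ),
        (A ⊗ₖ B) * ρ * (A ⊗ₖ B)ᴴ ≠ 0 ∧ SupportedOn ((A ⊗ₖ B) * ρ * (A ⊗ₖ B)ᴴ) ψ := by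
  induction P with
  | success =>
    intro ρ _ h0 hs
    refine ⟨1, 1, ?_⟩
    rw [Matrix.one_kronecker_one, Matrix.one_mul, Matrix.conjTranspose_one, Matrix.mul_one]
    exact ⟨h0, hs⟩
  | failure => exact fun _ h0 => absurd rfl h0
  | measureA K hK next ih =>
    intro ρ hρ h0 hs
    obtain ⟨i, -, hi⟩ := Finset.exists_ne_zero_of_sum_ne_zero h0
    obtain ⟨A, B, h1, h2⟩ := ih i (hρ.mul_mul_conjTranspose_same _) hi
      (SupportedOn.of_sum
        (fun k => (next k).posSemidef_output (hρ.mul_mul_conjTranspose_same _)) hs i)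
    rw [kronecker_conj_kronecker_conj] at h1 h2
    exact ⟨_, _, h1, h2⟩
  | measureB K hK next ih =>
    intro ρ hρ h0 hs
    obtain ⟨i, -, hi⟩ := Finset.exists_ne_zero_of_sum_ne_zero h0
    obtain ⟨A, B, h1, h2⟩ := ih i (hρ.mul_mul_conjTranspose_same _) hi
      (SupportedOn.of_sum
        (fun k => (next k).posSemidef_output (hρ.mul_mul_conjTranspose_same _)) hs i)
    rw [kronecker_conj_kronecker_conj] at h1 h2
    exact ⟨_, _, h1, h2⟩

/-- If `M ρ Mᴴ` is supported on `ψ`, then `M` maps the range of `ρ` into the line of `ψ`. -/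
theorem SupportedOn.exists_mulVec_eq_smul {ι κ : Type*} [Fintype ι] [Fintype κ]
    {ρ : Matrix κ κ ℂ} (hρ : ρ.PosSemidef) {M : Matrix ι κ ℂ} {ψ : ι → ℂ} (hψ : ψ ≠ 0)
    (h : SupportedOn (M * ρ * Mᴴ) ψ) (v : κ → ℂ) : ∃ t : ℂ, M *ᵥ (ρ *ᵥ v) = t • ψ := by
  classical
  obtain ⟨N, rfl⟩ := exists_eq_conjTranspose_mul_self hρ
  have hN : M * (Nᴴ * N) * Mᴴ = (N * Mᴴ)ᴴ * (N * Mᴴ) := by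
    simp [Matrix.mul_assoc]
  -- With `ρ = Nᴴ * N`, the quadratic form of `M ρ Mᴴ` at `u` is the squared norm of `N Mᴴ u`.
  have hker : ∀ u : ι → ℂ, star u ⬝ᵥ ψ = 0 → (N * Mᴴ) *ᵥ u = 0 := by
    intro u hu
    have h0 := h u hu
    rw [hN, ← Matrix.mulVec_mulVec, Matrix.dotProduct_mulVec,
      Matrix.vecMul_conjTranspose, star_star] at h0
    exact dotProduct_star_self_eq_zero.1 h0
  set φ := M *ᵥ ((Nᴴ * N) *ᵥ v) with hφ
  have horth : ∀ u : ι → ℂ, star u ⬝ᵥ ψ = 0 → star u ⬝ᵥ φ = 0 := by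
    intro u hu
    have h1 : φ = (N * Mᴴ)ᴴ *ᵥ (N *ᵥ v) := by
      simp [hφ, Matrix.mulVec_mulVec, Matrix.mul_assoc]
    rw [h1, Matrix.dotProduct_mulVec, Matrix.vecMul_conjTranspose, star_star, hker u hu]
    simp
  have hψ0 : star ψ ⬝ᵥ ψ ≠ 0 := fun h0 => hψ (dotProduct_star_self_eq_zero.1 h0)
  -- Orthogonal projection onto `ψ`: the remainder is orthogonal to `ψ`, hence to `φ` by `horth`,
  -- hence to itself.
  refine ⟨(star ψ ⬝ᵥ φ) / (star ψ ⬝ᵥ ψ), ?_⟩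
  set t := (star ψ ⬝ᵥ φ) / (star ψ ⬝ᵥ ψ)
  have h1 : star ψ ⬝ᵥ (φ - t • ψ) = 0 := by
    rw [dotProduct_sub, dotProduct_smul, smul_eq_mul, div_mul_cancel₀ _ hψ0, sub_self]
  have h2 : star (φ - t • ψ) ⬝ᵥ ψ = 0 := by
    have := congrArg star h1
    rwa [← Matrix.star_dotProduct, star_zero] at this
  have h3 : star (φ - t • ψ) ⬝ᵥ (φ - t • ψ) = 0 := by
    rw [dotProduct_sub, dotProduct_smul, h2, horth _ h2]
    simp
  exact sub_eq_zero.1 (dotProduct_star_self_eq_zero.1 h3)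

/-! ### Tensor products of pairs -/

/-- The vector `w₁ ⊗ ⋯ ⊗ wₙ`, with all qubits of either party grouped together. -/
def jointKet {n : ℕ} (w : Fin n → Fin 2 × Fin 2 → ℂ) : Fin (2 ^ n) × Fin (2 ^ n) → ℂ :=
  fun x => ∏ i, w i (finFunctionFinEquiv.symm x.1 i, finFunctionFinEquiv.symm x.2 i)

theorem sum_prod_finFunctionFinEquiv {n : ℕ} (f : Fin n → Fin 2 × Fin 2 → ℂ) :
    ∑ y : Fin (2 ^ n) × Fin (2 ^ n),
      ∏ i, f i (finFunctionFinEquiv.symm y.1 i, finFunctionFinEquiv.symm y.2 i) =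
      ∏ i, ∑ z, f i z := by
  rw [Finset.prod_univ_sum, Fintype.piFinset_univ]
  refine Fintype.sum_equiv ((Equiv.prodCongr finFunctionFinEquiv.symm
    finFunctionFinEquiv.symm).trans
      (Equiv.arrowProdEquivProdArrow (Fin n) (fun _ => Fin 2) (fun _ => Fin 2)).symm) _ _ fun y => ?_
  rfl

theorem jointState_mulVec_jointKet {n : ℕ} (ρ : Fin n → BipartiteOp 2 2)
    (v : Fin n → Fin 2 × Fin 2 → ℂ) :
    jointState ρ *ᵥ jointKet v = jointKet fun i => ρ i *ᵥ v i := by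
  ext x
  simp only [jointState, jointKet, Matrix.mulVec, dotProduct, Matrix.of_apply,
    ← Finset.prod_mul_distrib]
  exact sum_prod_finFunctionFinEquiv fun i z =>
    ρ i (finFunctionFinEquiv.symm x.1 i, finFunctionFinEquiv.symm x.2 i) z * v i z

theorem jointState_mul {n : ℕ} (ρ σ : Fin n → BipartiteOp 2 2) :
    jointState ρ * jointState σ = jointState fun i => ρ i * σ i := by
  ext x y
  simp only [jointState, Matrix.mul_apply, Matrix.of_apply, ← Finset.prod_mul_distrib]
  exact sum_prod_finFunctionFinEquiv fun i z =>
    ρ i (finFunctionFinEquiv.symm x.1 i, finFunctionFinEquiv.symm x.2 i) z *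
      σ i z (finFunctionFinEquiv.symm y.1 i, finFunctionFinEquiv.symm y.2 i)

theorem jointState_conjTranspose {n : ℕ} (ρ : Fin n → BipartiteOp 2 2) :
    (jointState ρ)ᴴ = jointState fun i => (ρ i)ᴴ := by
  ext x y
  simp [jointState, Matrix.conjTranspose_apply]

theorem posSemidef_jointState {n : ℕ} {ρ : Fin n → BipartiteOp 2 2}
    (h : ∀ i, (ρ i).PosSemidef) : (jointState ρ).PosSemidef := by
  choose N hN using fun i => exists_eq_conjTranspose_mul_self (h i)
  obtain rfl : ρ = fun i => (N i)ᴴ * N i := funext hN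
  rw [← jointState_mul, ← jointState_conjTranspose]
  exact Matrix.posSemidef_conjTranspose_mul_self _

theorem jointKet_update {n : ℕ} (w : Fin n → Fin 2 × Fin 2 → ℂ) (i : Fin n)
    (v : Fin 2 × Fin 2 → ℂ) (x : Fin (2 ^ n) × Fin (2 ^ n)) :
    jointKet (Function.update w i v) x =
      v (finFunctionFinEquiv.symm x.1 i, finFunctionFinEquiv.symm x.2 i) *
        ∏ j ∈ Finset.univ.erase i,
          w j (finFunctionFinEquiv.symm x.1 j, finFunctionFinEquiv.symm x.2 j) := by
  rw [jointKet, ← Finset.mul_prod_erase _ _ (Finset.mem_univ i), Function.update_self]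
  congr 1
  refine Finset.prod_congr rfl fun j hj => ?_
  rw [Function.update_of_ne (Finset.ne_of_mem_erase hj)]

/-- `jointKet` as a linear function of its factor number `i`. -/
def jointKetLinear {n : ℕ} (w : Fin n → Fin 2 × Fin 2 → ℂ) (i : Fin n) :
    (Fin 2 × Fin 2 → ℂ) →ₗ[ℂ] (Fin (2 ^ n) × Fin (2 ^ n) → ℂ) where
  toFun v := jointKet (Function.update w i v)
  map_add' v v' := by
    ext x
    simp only [jointKet_update, Pi.add_apply, add_mul]
  map_smul' c v := by
    ext x
    simp only [jointKet_update, Pi.smul_apply, smul_eq_mul, mul_assoc, RingHom.id_apply]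

/-- If all factors but number `i` are product vectors, then `jointKet` depends on factor number
`i` through a product operator. -/
theorem exists_unvec_jointKet_update {n : ℕ} {w : Fin n → Fin 2 × Fin 2 → ℂ} {i : Fin n}
    (h : ∀ j, j ≠ i → IsProductKet (w j)) :
    ∃ X Y : Matrix (Fin (2 ^ n)) (Fin 2) ℂ, ∀ v,
      unvec (jointKet (Function.update w i v)) = X * unvec v * Yᵀ := by
  have h' : ∀ j, ∃ x y : Fin 2 → ℂ, j ≠ i → w j = productKet x y := fun j => by
    by_cases hj : j = i
    · exact ⟨0, 0, fun h => absurd hj h⟩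
    · obtain ⟨x, y, hxy⟩ := h j hj
      exact ⟨x, y, fun _ => hxy⟩
  choose x y hxy using h'
  -- Column `k` is the basis vector `k` in slot `i`, tensored with the `x j` (for `Y`, the `y j`) in
  -- the other slots.
  refine ⟨Matrix.of fun p k => if finFunctionFinEquiv.symm p i = k then
      ∏ j ∈ Finset.univ.erase i, x j (finFunctionFinEquiv.symm p j) else 0,
    Matrix.of fun p k => if finFunctionFinEquiv.symm p i = k then
      ∏ j ∈ Finset.univ.erase i, y j (finFunctionFinEquiv.symm p j) else 0, fun v => ?_⟩
  ext p q
  have hw : ∏ j ∈ Finset.univ.erase i,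
      w j (finFunctionFinEquiv.symm p j, finFunctionFinEquiv.symm q j) =
      (∏ j ∈ Finset.univ.erase i, x j (finFunctionFinEquiv.symm p j)) *
        ∏ j ∈ Finset.univ.erase i, y j (finFunctionFinEquiv.symm q j) := by
    rw [← Finset.prod_mul_distrib]
    refine Finset.prod_congr rfl fun j hj => ?_
    rw [hxy j (Finset.ne_of_mem_erase hj)]
    rfl
  simp only [unvec, Matrix.of_apply, Matrix.mul_apply, Matrix.transpose_apply, jointKet_update,
    hw, ite_mul, mul_ite, zero_mul, mul_zero, Finset.sum_ite_eq, Finset.mem_univ, if_true]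
  ring

/-- Factors from spaces spanned by product vectors can be replaced by product vectors without
leaving the complement of the kernel of a linear map. -/
theorem exists_isProductKet_of_jointKet_ne_zero {n : ℕ} {V : Type*} [AddCommGroup V] [Module ℂ V]
    (L : (Fin (2 ^ n) × Fin (2 ^ n) → ℂ) →ₗ[ℂ] V) {ρ : Fin n → BipartiteOp 2 2}
    (h : ∃ w, (∀ i, w i ∈ opRange (ρ i)) ∧ L (jointKet w) ≠ 0) (s : Finset (Fin n))
    (hs : ∀ i ∈ s, RangeSpannedByProducts (ρ i)) :
    ∃ w, (∀ i, w i ∈ opRange (ρ i)) ∧ (∀ i ∈ s, IsProductKet (w i)) ∧ L (jointKet w) ≠ 0 := by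
  induction s using Finset.induction_on with
  | empty =>
    obtain ⟨w, hw, h0⟩ := h
    exact ⟨w, hw, by simp, h0⟩
  | insert i s hi ih =>
    obtain ⟨w, hw, hprod, h0⟩ := ih fun j hj => hs j (Finset.mem_insert_of_mem hj)
    obtain ⟨v, ⟨hv, hvp⟩, hv0⟩ : ∃ v ∈ {ψ | ψ ∈ opRange (ρ i) ∧ IsProductKet ψ},
        L (jointKetLinear w i v) ≠ 0 := by
      -- Otherwise the linear map vanishes on a spanning set of the range, hence at the old factor
      -- `w i`.
      by_contra! hcon
      have hle : opRange (ρ i) ≤ LinearMap.ker (L ∘ₗ jointKetLinear w i) := by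
        rw [← show _ = opRange (ρ i) from hs i (Finset.mem_insert_self i s)]
        exact Submodule.span_le.2 hcon
      have h1 : L (jointKet (Function.update w i (w i))) = 0 := hle (hw i)
      rw [Function.update_eq_self] at h1
      exact h0 h1
    refine ⟨Function.update w i v, fun j => ?_, fun j hj => ?_, hv0⟩
    · obtain rfl | hji := eq_or_ne j i
      · rwa [Function.update_self]
      · rw [Function.update_of_ne hji]
        exact hw j
    · obtain rfl | hji := eq_or_ne j i
      · rwa [Function.update_self]
      · rw [Function.update_of_ne hji]
        exact hprod j (Finset.mem_of_mem_insert_of_ne hj hji)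

/-! ### Pure states and the main argument -/

/-- A state whose range lies in the line of an entangled vector is pure and entangled. -/
theorem IsState.isPureEntangled {ρ : BipartiteOp 2 2} (hρ : IsState ρ) {w : Fin 2 × Fin 2 → ℂ}
    (hw : (unvec w).det ≠ 0) (h : ∀ v ∈ opRange ρ, ∃ t : ℂ, v = t • w) : IsPureEntangled ρ := by
  have hcol : ∀ j, ∃ t : ℂ, ρ.col j = t • w := fun j =>
    h _ ⟨Pi.single j 1, by simp⟩
  choose t ht using hcol
  have hent : ∀ i j, ρ i j = t j * w i := fun i j => congrFun (ht j) i
  obtain ⟨k, hk⟩ : ∃ k, w k ≠ 0 := by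
    by_contra! h0
    obtain rfl : w = 0 := funext h0
    exact hw (by simp [unvec, Matrix.det_fin_two])
  -- Comparing the entries `(k, j)` and `(j, k)` of the Hermitian `ρ` forces `t j = μ * star (w j)`.
  set μ : ℂ := star (t k) / w k
  have hform : ∀ i j, ρ i j = μ * (w i * star (w j)) := fun i j => by
    have hherm : t j * w k = star (t k * w j) := by
      rw [← hent, ← hent, hρ.1.isHermitian.apply]
    have : t j = μ * star (w j) := by
      rw [star_mul'] at hherm
      rw [div_mul_eq_mul_div, eq_div_iff hk, hherm]
    rw [hent, this]
    ring
  have hμ : 0 ≤ μ := by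
    have h1 : 0 ≤ ρ k k := hρ.1.diag_nonneg
    rw [hform] at h1
    have h2 : 0 < w k * star (w k) := by
      simpa using (mul_star_self_pos (isUnit_iff_ne_zero.2 hk).isRegular)
    have h3 := mul_nonneg h1 (inv_nonneg.2 h2.le)
    rwa [mul_assoc, mul_inv_cancel₀ h2.ne', mul_one] at h3
  have hμ0 : μ ≠ 0 := fun h0 => by
    have : ρ = 0 := by
      ext i j
      simp [hform, h0]
    simpa [this] using hρ.2
  obtain ⟨r, hr, hrμ⟩ : ∃ r : ℝ, 0 ≤ r ∧ (r : ℂ) = μ :=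
    ⟨μ.re, (Complex.nonneg_iff.1 hμ).1, Complex.ext rfl (Complex.nonneg_iff.1 hμ).2⟩
  have hsq : ((Real.sqrt r : ℝ) : ℂ) * (Real.sqrt r : ℝ) = μ := by
    rw [← Complex.ofReal_mul, Real.mul_self_sqrt hr, hrμ]
  refine ⟨((Real.sqrt r : ℝ) : ℂ) • w, ?_, fun hp => ?_⟩
  · ext i j
    simp only [ketBra, Matrix.vecMulVec_apply, Pi.smul_apply, Pi.star_apply, smul_eq_mul,
      star_mul', hform, ← hsq]
    rw [show star ((Real.sqrt r : ℝ) : ℂ) = (Real.sqrt r : ℝ) from Complex.conj_ofReal _]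
    ring
  · have h0 := det_unvec_eq_zero_of_isProductKet hp
    rw [unvec_smul, Matrix.det_smul] at h0
    refine mul_ne_zero (pow_ne_zero _ fun h1 => hμ0 ?_) hw h0
    rw [← hsq, h1, zero_mul]

/-- A product of invertible local operators reflects proportionality of vectors. -/
theorem eq_smul_of_mul_unvec_mul_eq {A B : Matrix (Fin 2) (Fin 2) ℂ} {v w : Fin 2 × Fin 2 → ℂ}
    (hA : A.det ≠ 0) (hB : B.det ≠ 0) {t : ℂ}
    (h : A * unvec v * Bᵀ = t • (A * unvec w * Bᵀ)) : v = t • w := by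
  refine unvec_injective ?_
  rw [unvec_smul]
  have hA' : IsUnit A := (Matrix.isUnit_iff_isUnit_det A).2 (isUnit_iff_ne_zero.2 hA)
  have hB' : IsUnit Bᵀ := (Matrix.isUnit_iff_isUnit_det _).2
    (by rw [Matrix.det_transpose]; exact isUnit_iff_ne_zero.2 hB)
  have h1 : A * unvec v * Bᵀ = A * (t • unvec w) * Bᵀ := by
    rw [h, Matrix.mul_smul, Matrix.smul_mul]
  exact hA'.mul_left_cancel (hB'.mul_right_cancel h1)

theorem lemma2 (n : ℕ) (ρ : Fin n → BipartiteOp 2 2)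
    (hρ : ∀ i, IsState (ρ i))
    (hmixed : ∀ i, ¬ IsPureEntangled (ρ i))
    (hdist : DistillableToSinglet (jointState ρ)) :
    ∃ i j, i ≠ j ∧ ¬ RangeSpannedByProducts (ρ i) ∧ ¬ RangeSpannedByProducts (ρ j) := by
  obtain ⟨P, p, ψ, hp, hψ, hout⟩ := hdist
  have hdet := hψ.det_unvec_ne_zero
  have hψ0 : ψ ≠ 0 := by
    rintro rfl
    exact hdet (by simp [unvec, Matrix.det_fin_two])
  have hpsd := posSemidef_jointState fun i => (hρ i).1
  have hout0 : P.output (jointState ρ) ≠ 0 := by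
    rw [hout, ketBra]
    refine smul_ne_zero (by exact_mod_cast hp.ne') fun h0 => ?_
    rcases Matrix.vecMulVec_eq_zero.1 h0 with h0 | h0
    · exact hψ0 h0
    · exact hψ0 (star_eq_zero.1 h0)
  obtain ⟨A, B, hne, hsupp⟩ := P.exists_branch hpsd hout0 (hout ▸ supportedOn_ketBra _ ψ)
  have hline : ∀ w : Fin n → Fin 2 × Fin 2 → ℂ, (∀ i, w i ∈ opRange (ρ i)) →
      ∃ t : ℂ, (A ⊗ₖ B) *ᵥ jointKet w = t • ψ := by
    intro w hw
    choose v hv using hw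
    obtain rfl : (fun i => ρ i *ᵥ v i) = w := funext hv
    rw [← jointState_mulVec_jointKet]
    exact hsupp.exists_mulVec_eq_smul hpsd hψ0 _
  have hex : ∃ w : Fin n → Fin 2 × Fin 2 → ℂ, (∀ i, w i ∈ opRange (ρ i)) ∧
      (A ⊗ₖ B).mulVecLin (jointKet w) ≠ 0 := by
    by_contra! hcon
    refine hne ?_
    -- Each column of the joint state is the `jointKet` of columns of the factors.
    have : (A ⊗ₖ B) * jointState ρ = 0 := by
      ext x y
      have h0 := hcon (fun i =>
        (ρ i).col (finFunctionFinEquiv.symm y.1 i, finFunctionFinEquiv.symm y.2 i))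
        fun i => ⟨Pi.single (finFunctionFinEquiv.symm y.1 i, finFunctionFinEquiv.symm y.2 i) 1,
          by simp⟩
      exact congrFun h0 x
    rw [this, Matrix.zero_mul]
  by_contra! hcon
  obtain ⟨w, hw, hprod, h0⟩ | hall : (∃ w, (∀ i, w i ∈ opRange (ρ i)) ∧
      (∃ i, ∀ j, j ≠ i → IsProductKet (w j)) ∧ (A ⊗ₖ B).mulVecLin (jointKet w) ≠ 0) ∨ n = 0 := by
    rcases n.eq_zero_or_pos with hn | hn
    · exact Or.inr hn
    left
    obtain ⟨i, hi⟩ : ∃ i, ∀ j, j ≠ i → RangeSpannedByProducts (ρ j) := by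
      by_cases hall : ∃ i, ¬ RangeSpannedByProducts (ρ i)
      · obtain ⟨i, hi⟩ := hall
        exact ⟨i, fun j hj => hcon i j hj.symm hi⟩
      · push Not at hall
        exact ⟨⟨0, hn⟩, fun j _ => hall j⟩
    obtain ⟨w, hw, hprod, h0⟩ := exists_isProductKet_of_jointKet_ne_zero _ hex
      (Finset.univ.erase i) fun j hj => hi j (Finset.ne_of_mem_erase hj)
    exact ⟨w, hw, ⟨i, fun j hj => hprod j (by simpa using hj)⟩, h0⟩
  · obtain ⟨i, hprod⟩ := hprod
    obtain ⟨X, Y, hXY⟩ := exists_unvec_jointKet_update hprod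
    have hL : ∀ v, unvec ((A ⊗ₖ B) *ᵥ jointKet (Function.update w i v)) =
        (A * X) * unvec v * (B * Y)ᵀ := fun v => by
      rw [unvec_kronecker_mulVec, hXY, Matrix.transpose_mul]
      simp only [Matrix.mul_assoc]
    obtain ⟨t₀, ht₀⟩ := hline w hw
    have ht₀0 : t₀ ≠ 0 := fun h => h0 (by
      rw [Matrix.mulVecLin_apply, ht₀, h, zero_smul])
    have hLw := hL (w i)
    rw [Function.update_eq_self, ht₀, unvec_smul] at hLw
    -- The product is the determinant of the coefficient matrix of `t₀ • ψ`; its three factors are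
    -- used separately below.
    have hdet' : (A * X).det * (unvec (w i)).det * (B * Y).det ≠ 0 := by
      rw [← Matrix.det_transpose (B * Y), ← Matrix.det_mul, ← Matrix.det_mul, ← hLw,
        Matrix.det_smul]
      exact mul_ne_zero (pow_ne_zero _ ht₀0) hdet
    refine hmixed i ((hρ i).isPureEntangled
      (right_ne_zero_of_mul (left_ne_zero_of_mul hdet')) fun v hv => ?_)
    obtain ⟨t, ht⟩ := hline (Function.update w i v) fun j => by
      obtain rfl | hji := eq_or_ne j i
      · rwa [Function.update_self]
      · rw [Function.update_of_ne hji]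
        exact hw j
    refine ⟨t / t₀, eq_smul_of_mul_unvec_mul_eq
      (left_ne_zero_of_mul (left_ne_zero_of_mul hdet')) (right_ne_zero_of_mul hdet') ?_⟩
    rw [← hL, ht, ← hLw, smul_smul, div_mul_cancel₀ _ ht₀0, unvec_smul]
  -- Without pairs there is no index `i`, but the joint vector is then a product vector, and its
  -- image cannot be entangled.
  · subst hall
    obtain ⟨w, hw, h0⟩ := hex
    obtain ⟨t, ht⟩ := hline w hw
    have hpk : IsProductKet ((A ⊗ₖ B) *ᵥ jointKet w) :=
      IsProductKet.kronecker_mulVec A B ⟨1, 1, by ext; simp [jointKet, productKet]⟩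
    have hd := det_unvec_eq_zero_of_isProductKet hpk
    rw [ht, unvec_smul, Matrix.det_smul] at hd
    refine mul_ne_zero (pow_ne_zero _ fun h => h0 ?_) hdet hd
    rw [Matrix.mulVecLin_apply, ht, h, zero_smul]
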